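/- **Model.** A sporadic task $\tau_i=(C_i,D_i,T_i)$ has worst-case execution time $C_i>0$, relative deadline $D_i>0$ and minimum inter-arrival time $T_i\in(0,\infty]$, with $C_i\le D_i$ and $C_i\le T_i$; there is no relation between $D_i$ and $T_i$ (arbitrary deadlines), and $T_i=\infty$ means that the task releases at most one job. A task set may generate any sequence of jobs in which consecutive releases of $\tau_i$ are at least $T_i$ apart; a job of $\tau_i$ needs at most $C_i$ units of processor time and must be finished at most $D_i$ after its release. Jobs are scheduled preemptively, with free migration, on $M\ge 2$ identical processors, and at each time at most one job of each task is executed, on at most one processor. Running the platform at speed $s$ replaces each $C_i$ by $C_i/s$. A task set is feasible if each job sequence that it can generate has a schedule meeting all deadlines. Global deadline-monotonic scheduling (global DM) executes, at each time, the $M$ highest-priority tasks that have unfinished jobs (all such tasks if there are fewer than $M$), each task through its earliest unfinished job; tasks with smaller $D_i$ have higher priority, and ties are broken by an arbitrary fixed rule. Global DM has speedup bound $s>0$ if, for each task set that is feasible on $M$ processors of speed $1$, global DM meets all deadlines of all job sequences of that task set on $M$ processors of speed $s$. **Theorem.** Let $M\ge 2$. 1. For every tie-breaking rule, every speedup bound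 $s$ of global DM on $M$ processors for arbitrary-deadline task systems satisfies $s\ge 3-\frac{3}{M+1}$. 2. Let $\varepsilon=1/n$ with a positive integer $n$. For all sufficiently small $\eta>0$ (depending on $\varepsilon$ and $M$), let $\mathbf T^{ad}$ be the set of $2M+1$ tasks with $C_i=\frac{\varepsilon}{3},\ T_i=\varepsilon,\ D_i=1$ for $1\le i\le M$; $C_i=\frac13,\ T_i=\infty,\ D_i=1+\eta$ for $M+1\le i\le 2M$; $C_{2M+1}=\frac{1+\varepsilon}{3},\ T_{2M+1}=\infty,\ D_{2M+1}=1+2\eta$. - At speed $1$, when all tasks release their first job at time $0$ and later jobs as early as possible, and each job needs its worst-case execution time, global DM (with any tie-breaking) misses the deadline of $\tau_{2M+1}$. - At every speed $v\ge\frac{1+\varepsilon}{3}+\frac{1+\varepsilon}{3M}$, each job sequence of $\mathbf T^{ad}$ has a schedule that meets all deadlines and is semi-partitioned: $\tau_m$ and $\tau_{M+m}$ receive processor time only on processor $m$ ($1\le m\le M$), and $\tau_{2M+1}$ receives at most $C_{2M+1}/(Mv)$ units of processor time on each processor. -/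

import Mathlib

open scoped ENNReal

namespace GlobalDM

/-- A sporadic task: worst-case execution time `C`, relative deadline `D`, minimum inter-arrival
time `T`. The value `T = ⊤` describes a one-shot task, which releases at most one job. -/
structure Task where
  C : ℝ
  D : ℝ
  T : ℝ≥0∞

/-- Admissible parameters: `C, D, T > 0`, `C / D ≤ 1` and `C / T ≤ 1`. -/
def Task.Valid (a : Task) : Prop :=
  0 < a.C ∧ 0 < a.D ∧ 0 < a.T ∧ a.C ≤ a.D ∧ ENNReal.ofReal a.C ≤ a.T

/-- Running the platform at speed `s` turns the worst-case execution time `C` into `C / s`. -/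
noncomputable def atSpeed {N : ℕ} (s : ℝ) (τ : Fin N → Task) : Fin N → Task :=
  fun i => { C := (τ i).C / s, D := (τ i).D, T := (τ i).T }

/-- A job sequence of `N` tasks: job `j` of task `i` is released at time `release i j`
(`⊤` means that it is never released) and needs `exec i j` units of processor time. -/
structure Jobs (N : ℕ) where
  release : Fin N → ℕ → ℝ≥0∞
  exec : Fin N → ℕ → ℝ

/-- The job sequences that a sporadic task set can generate: consecutive releases of a task are
at least its minimum inter-arrival time apart, and no job exceeds the worst-case execution time. -/
def Jobs.Legal {N : ℕ} (τ : Fin N → Task) (J : Jobs N) : Prop :=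
  (∀ i j, J.release i j + (τ i).T ≤ J.release i (j + 1)) ∧
  ∀ i j, 0 < J.exec i j ∧ J.exec i j ≤ (τ i).C

/-- All tasks release their first job at time `0` and later jobs as early as possible, and each
job needs its worst-case execution time. -/
noncomputable def synchronous {N : ℕ} (τ : Fin N → Task) : Jobs N where
  release i j := (j : ℝ≥0∞) * (τ i).T
  exec i _ := (τ i).C

/-- At each time, each of the `M` processors is idle (`none`) or executes one job
(`some (i, j)`: job `j` of task `i`). Only times `t ≥ 0` matter. -/
structure Schedule (M N : ℕ) where
  run : Fin M → ℝ → Option (Fin N × ℕ)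
  measurableSet_run : ∀ m i j, MeasurableSet {t | run m t = some (i, j)}

/-- Processor time that job `j` of task `i` receives on processor `m` during `[0, t)`. -/
noncomputable def Schedule.serviceOn {M N : ℕ} (S : Schedule M N) (m : Fin M) (i : Fin N) (j : ℕ)
    (t : ℝ) : ℝ :=
  (MeasureTheory.volume ({u | S.run m u = some (i, j)} ∩ Set.Ico 0 t)).toReal

/-- Processor time that job `j` of task `i` receives in total during `[0, t)`. -/
noncomputable def Schedule.service {M N : ℕ} (S : Schedule M N) (i : Fin N) (j : ℕ) (t : ℝ) : ℝ :=
  ∑ m, S.serviceOn m i j t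

/-- Job `j` of task `i` is released by time `t` and not finished before `t`. -/
def Schedule.Pending {M N : ℕ} (S : Schedule M N) (J : Jobs N) (i : Fin N) (j : ℕ) (t : ℝ) :
    Prop :=
  J.release i j ≤ ENNReal.ofReal t ∧ S.service i j t < J.exec i j

/-- `S` is a schedule of the job sequence `J`: only pending jobs are executed, and at each time at
most one job of each task is executed, on at most one processor. Preemption and migration are
unrestricted. -/
def Schedule.IsScheduleOf {M N : ℕ} (S : Schedule M N) (J : Jobs N) : Prop :=
  (∀ t, 0 ≤ t → ∀ m i j, S.run m t = some (i, j) → S.Pending J i j t) ∧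
  ∀ t, 0 ≤ t → ∀ m m' i j j',
    S.run m t = some (i, j) → S.run m' t = some (i, j') → m = m'

/-- Job `j` of task `i`, if released at all, is finished by its absolute deadline. -/
def Schedule.MeetsDeadline {M N : ℕ} (S : Schedule M N) (τ : Fin N → Task) (J : Jobs N)
    (i : Fin N) (j : ℕ) : Prop :=
  J.release i j ≠ ⊤ → J.exec i j ≤ S.service i j ((J.release i j).toReal + (τ i).D)

/-- The task set can be feasibly scheduled on `M` unit-speed processors: each job sequence that it
can generate has a schedule in which all deadlines are met. -/
def Feasible {N : ℕ} (M : ℕ) (τ : Fin N → Task) : Prop :=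
  ∀ J : Jobs N, J.Legal τ →
    ∃ S : Schedule M N, S.IsScheduleOf J ∧ ∀ i j, S.MeetsDeadline τ J i j

/-- Feasibility by semi-partitioned scheduling: task `i` is statically divided into subtasks, the
one on processor `m` having execution time `b i m`. A task with a single nonzero entry is assigned
to one processor. -/
def SemiPartitionedFeasible {N : ℕ} (M : ℕ) (τ : Fin N → Task) (b : Fin N → Fin M → ℝ) : Prop :=
  (∀ i m, 0 ≤ b i m) ∧ (∀ i, ∑ m, b i m = (τ i).C) ∧
  ∀ J : Jobs N, J.Legal τ →
    ∃ S : Schedule M N, S.IsScheduleOf J ∧ (∀ i j, S.MeetsDeadline τ J i j) ∧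
      ∀ i j m t, S.serviceOn m i j t ≤ b i m

/-- Task `i` has an unfinished job at time `t`. -/
def Schedule.Active {M N : ℕ} (S : Schedule M N) (J : Jobs N) (i : Fin N) (t : ℝ) : Prop :=
  ∃ j, S.Pending J i j t

/-- `S` is the preemptive global fixed-priority schedule of `J`, where `prio i < prio k` means that
task `i` has higher priority than task `k`: at each time exactly the `M` highest-priority active
tasks (all of them if there are fewer) are executed, each through its earliest pending job. -/
def Schedule.IsGlobalFP {M N : ℕ} (S : Schedule M N) (J : Jobs N) (prio : Equiv.Perm (Fin N)) :
    Prop :=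
  S.IsScheduleOf J ∧
  ∀ t, 0 ≤ t → ∀ i j, (∃ m, S.run m t = some (i, j)) ↔
    (S.Pending J i j t ∧ (∀ j' < j, ¬ S.Pending J i j' t) ∧
      Set.ncard {k | S.Active J k t ∧ prio k < prio i} < M)

/-- Deadline-monotonic priorities: shorter relative deadlines get higher priority; ties may be
broken in any way. -/
def IsDM {N : ℕ} (τ : Fin N → Task) (prio : Equiv.Perm (Fin N)) : Prop :=
  ∀ i k, (τ i).D < (τ k).D → prio i < prio k

/-- Deadline-monotonic priority assignment with some rule for breaking ties. -/
structure DMRule where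
  assign : ∀ N : ℕ, (Fin N → Task) → Equiv.Perm (Fin N)
  isDM : ∀ N τ, IsDM τ (assign N τ)

/-- Global DM meets all deadlines of all job sequences that the task set can generate. -/
def DMSchedulable {N : ℕ} (M : ℕ) (rule : DMRule) (τ : Fin N → Task) : Prop :=
  ∀ J : Jobs N, J.Legal τ → ∀ S : Schedule M N, S.IsGlobalFP J (rule.assign N τ) →
    ∀ i j, S.MeetsDeadline τ J i j

/-- Global DM has speedup bound `s` on `M` processors: whenever a task set is feasible on `M`
processors of speed `1`, global DM schedules it on `M` processors of speed `s`. -/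
def HasSpeedupBound (M : ℕ) (rule : DMRule) (s : ℝ) : Prop :=
  0 < s ∧ ∀ (N : ℕ) (τ : Fin N → Task), (∀ i, (τ i).Valid) → Feasible M τ →
    DMSchedulable M rule (atSpeed s τ)

/-- The task set with `M` tasks `(ε/3, 1, ε)`, `M` one-shot tasks `(1/3, 1 + η, ∞)` and one
one-shot task `((1 + ε)/3, 1 + 2η, ∞)`, in the order `(C, D, T)`. -/
noncomputable def adTasks (M : ℕ) (ε η : ℝ) : Fin (2 * M + 1) → Task := fun i =>
  if i.val < M then { C := ε / 3, D := 1, T := ENNReal.ofReal ε }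
  else if i.val < 2 * M then { C := 1 / 3, D := 1 + η, T := ⊤ }
  else { C := (1 + ε) / 3, D := 1 + 2 * η, T := ⊤ }

/-- The static division that assigns tasks `m` and `M + m` to processor `m` and splits the last
task evenly among all processors. -/
noncomputable def adSplit (M : ℕ) (τ : Fin (2 * M + 1) → Task) (i : Fin (2 * M + 1)) (m : Fin M) :
    ℝ :=
  if i = Fin.last (2 * M) then (τ i).C / M
  else if i.val = m.val ∨ i.val = M + m.val then (τ i).C
  else 0

end GlobalDM

/-!
When all tasks of `adTasks` are released together, global DM runs the `M` periodic tasks in parallel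
during the first third of each period. The `M` one-shot tasks are then executed in parallel during
the first `1/3` units of the remaining time, and the last task gets only what is left. Since the
periodic tasks leave at most `2/3 * x` units of time before time `x`, this is less than
`(1 + ε) / 3` units before the deadline `1 + 2 * η` as soon as `η < ε / 4`.

A semi-partitioned schedule at speed `v` instead lets the last task visit the processors one after
the other, for an equal share of its execution time each, and then serves on each processor the
one-shot task before the periodic one. The share and the one-shot task delay the periodic jobs of
their processor only once, by `(1 + ε) / (3 * M * v) + 1 / (3 * v)` units in total, so that all
deadlines are met if this and the execution time `ε / (3 * v)` add up to at most `1`.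

Hence `adTasks` becomes feasible when scaled to a speed near `1/3 + 1/(3 * M) = (M + 1) / (3 * M)`,
the inverse of `3 - 3 / (M + 1)`, while global DM fails on the unscaled tasks.
-/

namespace GlobalDM

open Function MeasureTheory Set

section GreedyExecution

theorem measureReal_le_add_of_subset_union {α : Type*} [MeasurableSpace α] {μ : Measure α}
    {X Y Z : Set α} (h : X ⊆ Y ∪ Z) (hY : μ Y ≠ ∞) (hZ : μ Z ≠ ∞) :
    μ.real X ≤ μ.real Y + μ.real Z :=
  (measureReal_mono h (measure_union_ne_top hY hZ)).trans (measureReal_union_le Y Z)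

theorem volume_inter_Ico_ne_top (A : Set ℝ) (a b : ℝ) : volume (A ∩ Ico a b) ≠ ∞ :=
  measure_ne_top_of_subset inter_subset_right (by simp)

theorem monotone_measureReal_inter_Ico (A : Set ℝ) (a : ℝ) :
    Monotone fun t => volume.real (A ∩ Ico a t) := fun _ t h =>
  measureReal_mono (inter_subset_inter_right _ (Ico_subset_Ico_right h))
    (volume_inter_Ico_ne_top A a t)

theorem measureReal_inter_Ico_le_add (A : Set ℝ) (a : ℝ) {s t : ℝ} (h : s ≤ t) :
    volume.real (A ∩ Ico a t) ≤ volume.real (A ∩ Ico a s) + (t - s) := by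
  rw [← Real.volume_real_Ico_of_le h]
  refine measureReal_le_add_of_subset_union ?_ (volume_inter_Ico_ne_top A a s) (by simp)
  rintro u ⟨hu, hau, hut⟩
  exact (lt_or_ge u s).imp (fun hus => ⟨hu, hau, hus⟩) fun hsu => ⟨hsu, hut⟩

theorem continuous_measureReal_inter_Ico (A : Set ℝ) (a : ℝ) :
    Continuous fun t => volume.real (A ∩ Ico a t) := by
  refine (LipschitzWith.of_le_add fun s t => ?_).continuous
  rcases le_total s t with h | h
  · exact (monotone_measureReal_inter_Ico A a h).trans (le_add_of_nonneg_right dist_nonneg)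
  · rw [Real.dist_eq, abs_of_nonneg (sub_nonneg.2 h)]
    exact measureReal_inter_Ico_le_add A a h

theorem exists_measureReal_inter_Ico_eq {A : Set ℝ} {a x c : ℝ} (hc : 0 ≤ c)
    (hx : c ≤ volume.real (A ∩ Ico a x)) : ∃ y, volume.real (A ∩ Ico a y) = c :=
  mem_range_of_exists_le_of_exists_ge (continuous_measureReal_inter_Ico A a)
    ⟨a, by simpa using hc⟩ ⟨x, hx⟩

/-- The times at which a job with release time `r` and execution time `e` runs if it uses the
available times `A` as early as possible. -/
def greedy (A : Set ℝ) (r : ℝ≥0∞) (e : ℝ) : Set ℝ :=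
  {t | t ∈ A ∧ 0 ≤ t ∧ r ≤ ENNReal.ofReal t ∧ volume.real (A ∩ Ico r.toReal t) < e}

variable {A : Set ℝ} {r : ℝ≥0∞} {e x : ℝ}

theorem greedy_subset : greedy A r e ⊆ A := fun _ h => h.1

theorem measurableSet_greedy (hA : MeasurableSet A) : MeasurableSet (greedy A r e) := by
  have hrelease : MeasurableSet {t : ℝ | r ≤ ENNReal.ofReal t} :=
    measurableSet_le measurable_const ENNReal.measurable_ofReal
  have hunfinished : MeasurableSet {t : ℝ | volume.real (A ∩ Ico r.toReal t) < e} :=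
    measurableSet_lt (continuous_measureReal_inter_Ico A _).measurable measurable_const
  exact hA.inter (measurableSet_Ici.inter (hrelease.inter hunfinished))

theorem toReal_le_of_mem_greedy {t : ℝ} (ht : t ∈ greedy A r e) : r.toReal ≤ t :=
  ENNReal.toReal_le_of_le_ofReal ht.2.1 ht.2.2.1

theorem greedy_inter_Ico_subset : greedy A r e ∩ Ico 0 x ⊆ A ∩ Ico r.toReal x :=
  fun _ ht => ⟨ht.1.1, toReal_le_of_mem_greedy ht.1, ht.2.2⟩

theorem measureReal_greedy_inter_le_left :
    volume.real (greedy A r e ∩ Ico 0 x) ≤ volume.real (A ∩ Ico r.toReal x) :=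
  measureReal_mono greedy_inter_Ico_subset (volume_inter_Ico_ne_top A _ x)

theorem measureReal_greedy_inter_le (he : 0 ≤ e) :
    volume.real (greedy A r e ∩ Ico 0 x) ≤ e := by
  rcases le_total (volume.real (A ∩ Ico r.toReal x)) e with hx | hx
  · exact measureReal_greedy_inter_le_left.trans hx
  · obtain ⟨y, hy⟩ := exists_measureReal_inter_Ico_eq he hx
    rw [← hy]
    refine measureReal_mono (fun t ht => ?_) (volume_inter_Ico_ne_top A _ y)
    have hty : t < y := (monotone_measureReal_inter_Ico A r.toReal).reflect_lt
      (hy ▸ ht.1.2.2.2)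
    exact ⟨ht.1.1, toReal_le_of_mem_greedy ht.1, hty⟩

theorem min_le_measureReal_greedy_inter (hr : r ≠ ⊤) :
    min (volume.real (A ∩ Ico r.toReal x)) e ≤ volume.real (greedy A r e ∩ Ico 0 x) := by
  refine le_of_forall_lt_imp_le_of_dense fun c hc => ?_
  obtain ⟨hcx, hce⟩ := lt_min_iff.1 hc
  rcases lt_or_ge c 0 with hc0 | hc0
  · exact hc0.le.trans measureReal_nonneg
  obtain ⟨y, hy⟩ := exists_measureReal_inter_Ico_eq hc0 hcx.le
  have hmono := monotone_measureReal_inter_Ico A r.toReal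
  have hyx : y < x := hmono.reflect_lt (hy.trans_lt hcx)
  rw [← hy]
  refine measureReal_mono (fun t ⟨htA, hrt, hty⟩ => ?_) (volume_inter_Ico_ne_top _ 0 x)
  have ht0 : 0 ≤ t := ENNReal.toReal_nonneg.trans hrt
  exact ⟨⟨htA, ht0, (ENNReal.le_ofReal_iff_toReal_le hr ht0).2 hrt,
    (hmono hty.le).trans_lt (hy.trans_lt hce)⟩, ht0, hty.trans hyx⟩

theorem measureReal_greedy_inter (hr : r ≠ ⊤) (he : 0 ≤ e) :
    volume.real (greedy A r e ∩ Ico 0 x) = min (volume.real (A ∩ Ico r.toReal x)) e :=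
  le_antisymm (le_min measureReal_greedy_inter_le_left (measureReal_greedy_inter_le he))
    (min_le_measureReal_greedy_inter hr)

theorem measureReal_greedy_inter_lt {t : ℝ} (ht : t ∈ greedy A r e) :
    volume.real (greedy A r e ∩ Ico 0 t) < e :=
  measureReal_greedy_inter_le_left.trans_lt ht.2.2.2

theorem le_measureReal_greedy_inter (hr : r ≠ ⊤) (hx : e ≤ volume.real (A ∩ Ico r.toReal x)) :
    e ≤ volume.real (greedy A r e ∩ Ico 0 x) :=
  (le_min hx le_rfl).trans (min_le_measureReal_greedy_inter hr)

theorem measureReal_sdiff_greedy_inter (hA : MeasurableSet A) (he : 0 ≤ e) :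
    volume.real ((A \ greedy A 0 e) ∩ Ico 0 x) = max (volume.real (A ∩ Ico 0 x) - e) 0 := by
  have hsplit := measureReal_inter_add_sdiff (μ := volume) (s := A ∩ Ico 0 x)
    (measurableSet_greedy (r := 0) (e := e) hA) (volume_inter_Ico_ne_top A 0 x)
  have hgreedy := measureReal_greedy_inter (A := A) (x := x) ENNReal.zero_ne_top he
  rw [inter_right_comm, inter_eq_right.2 greedy_subset, hgreedy, ENNReal.toReal_zero,
    inter_sdiff_right_comm] at hsplit
  rw [← sub_eq_of_eq_add' hsplit.symm, ← max_sub_sub_left, sub_self, max_comm]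

end GreedyExecution

section FreeTimes

/-- A processor that is available during `A` loses at most `K` units of processor time in every
interval. -/
def HasBoundedDelay (A : Set ℝ) (K : ℝ) : Prop :=
  ∀ s x, 0 ≤ s → x - s - K ≤ volume.real (A ∩ Ico s x)

theorem hasBoundedDelay_Ici : HasBoundedDelay (Ici 0) 0 := fun s x hs => by
  rw [inter_eq_right.2 (Ico_subset_Ici_self.trans (Ici_subset_Ici.2 hs)), Real.volume_real_Ico,
    sub_zero]
  exact le_max_left _ _

theorem HasBoundedDelay.sdiff {A V : Set ℝ} {K k : ℝ} (hA : HasBoundedDelay A K)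
    (hV : ∀ x, volume.real (V ∩ Ico 0 x) ≤ k) : HasBoundedDelay (A \ V) (K + k) := by
  intro s x hs
  have hsub : A ∩ Ico s x ⊆ (A \ V) ∩ Ico s x ∪ V ∩ Ico 0 x := by
    rintro u ⟨hu, hsu, hux⟩
    exact (em (u ∈ V)).symm.imp (fun hv => ⟨⟨hu, hv⟩, hsu, hux⟩)
      fun hv => ⟨hv, hs.trans hsu, hux⟩
  linarith [hA s x hs, hV x, measureReal_le_add_of_subset_union hsub
    (volume_inter_Ico_ne_top (A \ V) s x) (volume_inter_Ico_ne_top V 0 x)]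

/-- The times left free by the first `j` jobs, when each job in turn greedily uses what the
previous ones leave of `A`. -/
def freeTimes (A : Set ℝ) (r : ℕ → ℝ≥0∞) (e : ℕ → ℝ) : ℕ → Set ℝ
  | 0 => A
  | j + 1 => freeTimes A r e j \ greedy (freeTimes A r e j) (r j) (e j)

variable {A : Set ℝ} {r : ℕ → ℝ≥0∞} {e : ℕ → ℝ}

theorem measurableSet_freeTimes (hA : MeasurableSet A) (j : ℕ) :
    MeasurableSet (freeTimes A r e j) := by
  induction j with
  | zero => exact hA
  | succ j ih => exact ih.diff (measurableSet_greedy ih)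

theorem antitone_freeTimes : Antitone (freeTimes A r e) :=
  antitone_nat_of_succ_le fun _ => sdiff_subset

theorem pairwise_disjoint_greedy_freeTimes :
    Pairwise (Disjoint on fun j => greedy (freeTimes A r e j) (r j) (e j)) :=
  (pairwise_disjoint_on _).2 fun _ _ hij => disjoint_left.2 fun _ hi hj =>
    (antitone_freeTimes (Nat.succ_le_of_lt hij) hj.1).2 hi

theorem mem_freeTimes_of_le {t u : ℝ} {j : ℕ} (ht0 : 0 ≤ t) (ht : t ∈ freeTimes A r e j)
    (hr : ∀ i < j, r i ≤ ENNReal.ofReal t) (htu : t ≤ u) (hu : u ∈ A) :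
    u ∈ freeTimes A r e j := by
  induction j with
  | zero => exact hu
  | succ j ih =>
    refine ⟨ih ht.1 fun i hi => hr i (hi.trans j.lt_succ_self), fun hrun => ht.2 ?_⟩
    exact ⟨ht.1, ht0, hr j j.lt_succ_self,
      (monotone_measureReal_inter_Ico _ _ htu).trans_lt hrun.2.2.2⟩

/-- A job that is not delayed beyond the next release leaves all of `A` to its successors; one that
is delayed occupies no more than the distance of the two releases. -/
theorem HasBoundedDelay.le_measureReal_freeTimes {K : ℝ} (hA : HasBoundedDelay A K)
    (hr : ∀ j, r j + ENNReal.ofReal (e j) ≤ r (j + 1)) (he : ∀ j, 0 ≤ e j) (j : ℕ)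
    (hj : r j ≠ ⊤) (x : ℝ) :
    x - (r j).toReal - K ≤ volume.real (freeTimes A r e j ∩ Ico (r j).toReal x) := by
  induction j generalizing x with
  | zero => exact hA _ _ ENNReal.toReal_nonneg
  | succ j ih =>
    have hmono : Monotone r := monotone_nat_of_le_succ fun i => le_self_add.trans (hr i)
    have hj' : r j ≠ ⊤ := ne_top_of_le_ne_top hj (hmono j.le_succ)
    by_cases hfree : ∃ t ∈ freeTimes A r e (j + 1), (r j).toReal ≤ t ∧ t < (r (j + 1)).toReal
    · obtain ⟨t, ht, hjt, htj⟩ := hfree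
      have ht0 : 0 ≤ t := ENNReal.toReal_nonneg.trans hjt
      have hreleased : ∀ i < j + 1, r i ≤ ENNReal.ofReal t := fun i hi =>
        (hmono (Nat.le_of_lt_succ hi)).trans ((ENNReal.le_ofReal_iff_toReal_le hj' ht0).2 hjt)
      refine (hA _ x ENNReal.toReal_nonneg).trans (measureReal_mono ?_
        (volume_inter_Ico_ne_top _ _ x))
      exact fun u ⟨huA, hju, hux⟩ =>
        ⟨mem_freeTimes_of_le ht0 ht hreleased (htj.le.trans hju) huA, hju, hux⟩
    · push Not at hfree
      have hsub : freeTimes A r e j ∩ Ico (r j).toReal x ⊆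
          freeTimes A r e (j + 1) ∩ Ico (r (j + 1)).toReal x ∪
            greedy (freeTimes A r e j) (r j) (e j) ∩ Ico 0 x := by
        rintro u ⟨hu, hju, hux⟩
        by_cases hrun : u ∈ greedy (freeTimes A r e j) (r j) (e j)
        · exact Or.inr ⟨hrun, hrun.2.1, hux⟩
        · exact Or.inl ⟨⟨hu, hrun⟩, hfree u ⟨hu, hrun⟩ hju, hux⟩
      have hgap : (r j).toReal + e j ≤ (r (j + 1)).toReal := by
        rw [← ENNReal.toReal_ofReal (he j), ← ENNReal.toReal_add hj' ENNReal.ofReal_ne_top]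
        exact ENNReal.toReal_mono hj (hr j)
      linarith [ih hj' x, measureReal_greedy_inter_le (A := freeTimes A r e j) (r := r j)
        (x := x) (he j), measureReal_le_add_of_subset_union hsub
        (volume_inter_Ico_ne_top _ _ x) (volume_inter_Ico_ne_top _ 0 x)]

end FreeTimes

section Slots

theorem pairwise_disjoint_Ico_add_mul (a p : ℝ) :
    Pairwise (Disjoint on fun n : ℕ => Ico (a + n * p) (a + (n + 1) * p)) := by
  have h := (pairwise_disjoint_Ico_add_zsmul a p).comp_of_injective Nat.cast_injective
  simpa [Function.onFun, Pairwise] using h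

/-- The `n`-th of consecutive time slots of length `d`, the first of which starts at time `r`.
Written as a greedy execution, it is empty for `r = ⊤`. -/
def slot (r : ℝ≥0∞) (d : ℝ) (n : ℕ) : Set ℝ :=
  greedy (Ici (r.toReal + n * d)) r d

variable {r : ℝ≥0∞} {d : ℝ} {n : ℕ}

theorem slot_subset_Ico : slot r d n ⊆ Ico (r.toReal + n * d) (r.toReal + (n + 1) * d) := by
  rintro t ⟨hnt, -, -, hlt⟩
  have hd : 0 < d := measureReal_nonneg.trans_lt hlt
  have hrn : r.toReal ≤ r.toReal + n * d := by
    have : 0 ≤ n * d := by positivity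
    linarith
  rw [← Ici_inter_Iio, ← inter_assoc, Ici_inter_Ici, max_eq_left hrn, Ici_inter_Iio,
    Real.volume_real_Ico_of_le hnt] at hlt
  exact ⟨hnt, by linarith⟩

theorem pairwise_disjoint_slot (r : ℝ≥0∞) (d : ℝ) : Pairwise (Disjoint on slot r d) :=
  (pairwise_disjoint_Ico_add_mul r.toReal d).mono fun _ _ h =>
    h.mono slot_subset_Ico slot_subset_Ico

theorem le_measureReal_slot_inter (hr : r ≠ ⊤) (hd : 0 ≤ d) {t : ℝ}
    (ht : r.toReal + (n + 1) * d ≤ t) : d ≤ volume.real (slot r d n ∩ Ico 0 t) := by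
  refine le_measureReal_greedy_inter hr ?_
  have hrn : r.toReal ≤ r.toReal + n * d := by
    have : 0 ≤ n * d := by positivity
    linarith
  rw [← Ici_inter_Iio, ← inter_assoc, Ici_inter_Ici, max_eq_left hrn, Ici_inter_Iio,
    Real.volume_real_Ico_of_le (by linarith)]
  linarith

end Slots

namespace Schedule

variable {M N : ℕ} {E : Fin M → Fin N × ℕ → Set ℝ} (hE : ∀ m p, MeasurableSet (E m p))
  (hdisj : ∀ m, Pairwise (Disjoint on E m))

include hdisj in
open Classical in
theorem dite_choose_eq_some_iff {m : Fin M} {t : ℝ} {p : Fin N × ℕ} :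
    (if h : ∃ q, t ∈ E m q then some h.choose else none) = some p ↔ t ∈ E m p := by
  refine ⟨fun h => ?_, fun h => ?_⟩
  · split_ifs at h with hex
    exact Option.some.inj h ▸ hex.choose_spec
  · have hex : ∃ q, t ∈ E m q := ⟨p, h⟩
    rw [dif_pos hex, (hdisj m).eq (not_disjoint_iff.2 ⟨t, hex.choose_spec, h⟩)]

open Classical in
/-- The schedule in which processor `m` executes job `p` exactly during `E m p`. -/
noncomputable def ofSets : Schedule M N where
  run m t := if h : ∃ p, t ∈ E m p then some h.choose else none
  measurableSet_run m i j := by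
    simp only [dite_choose_eq_some_iff hdisj]
    exact hE m (i, j)

theorem run_ofSets {m : Fin M} {t : ℝ} {p : Fin N × ℕ} :
    (ofSets hE hdisj).run m t = some p ↔ t ∈ E m p :=
  dite_choose_eq_some_iff hdisj

theorem serviceOn_ofSets (m : Fin M) (i : Fin N) (j : ℕ) (t : ℝ) :
    (ofSets hE hdisj).serviceOn m i j t = volume.real (E m (i, j) ∩ Ico 0 t) := by
  simp only [serviceOn, run_ofSets]
  rfl

end Schedule

section Tasks

variable {M : ℕ}

/-- The index of the `m`-th periodic task of `adTasks`, which is assigned to processor `m`. -/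
def periodicTask (m : Fin M) : Fin (2 * M + 1) := ⟨m, by omega⟩

/-- The index of the `m`-th one-shot task of `adTasks`, which is assigned to processor `m`. -/
def oneShotTask (m : Fin M) : Fin (2 * M + 1) := ⟨M + m, by omega⟩

@[elab_as_elim]
theorem taskCases {motive : Fin (2 * M + 1) → Prop} (periodic : ∀ m, motive (periodicTask m))
    (oneShot : ∀ m, motive (oneShotTask m)) (last : motive (Fin.last (2 * M)))
    (i : Fin (2 * M + 1)) : motive i := by
  obtain hi | hi := lt_or_ge i.val M
  · exact periodic ⟨i, hi⟩
  obtain hi' | hi' := lt_or_ge i.val (2 * M)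
  · convert oneShot ⟨i - M, by omega⟩
    simp only [oneShotTask, Fin.ext_iff]
    omega
  · convert last
    simp only [Fin.ext_iff, Fin.val_last]
    omega

@[simp]
theorem periodicTask_inj {m m' : Fin M} : periodicTask m = periodicTask m' ↔ m = m' := by
  simp [periodicTask, Fin.ext_iff]

@[simp]
theorem oneShotTask_inj {m m' : Fin M} : oneShotTask m = oneShotTask m' ↔ m = m' := by
  simp [oneShotTask, Fin.ext_iff]

@[simp]
theorem periodicTask_ne_oneShotTask (m m' : Fin M) : periodicTask m ≠ oneShotTask m' := by
  simp only [periodicTask, oneShotTask, ne_eq, Fin.ext_iff]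
  omega

@[simp]
theorem periodicTask_ne_last (m : Fin M) : periodicTask m ≠ Fin.last (2 * M) := by
  simp only [periodicTask, ne_eq, Fin.ext_iff, Fin.val_last]
  omega

@[simp]
theorem oneShotTask_ne_last (m : Fin M) : oneShotTask m ≠ Fin.last (2 * M) := by
  simp only [oneShotTask, ne_eq, Fin.ext_iff, Fin.val_last]
  omega

variable (ε η : ℝ)

@[simp]
theorem adTasks_periodicTask (m : Fin M) :
    adTasks M ε η (periodicTask m) = { C := ε / 3, D := 1, T := ENNReal.ofReal ε } := by
  simp [adTasks, periodicTask]

@[simp]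
theorem adTasks_oneShotTask (m : Fin M) :
    adTasks M ε η (oneShotTask m) = { C := 1 / 3, D := 1 + η, T := ⊤ } := by
  have hm : M + m.val < 2 * M := by omega
  simp [adTasks, oneShotTask, hm]

@[simp]
theorem adTasks_last :
    adTasks M ε η (Fin.last (2 * M)) = { C := (1 + ε) / 3, D := 1 + 2 * η, T := ⊤ } := by
  have hM : ¬ 2 * M < M := by omega
  simp [adTasks, hM]

variable (τ : Fin (2 * M + 1) → Task)

theorem adSplit_periodicTask (m m' : Fin M) :
    adSplit M τ (periodicTask m) m' = if m' = m then (τ (periodicTask m)).C else 0 := by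
  have hm : (periodicTask m).val = m'.val ∨ (periodicTask m).val = M + m'.val ↔ m' = m := by
    simp only [periodicTask, Fin.ext_iff]
    omega
  simp only [adSplit, if_neg (periodicTask_ne_last m), hm]

theorem adSplit_oneShotTask (m m' : Fin M) :
    adSplit M τ (oneShotTask m) m' = if m' = m then (τ (oneShotTask m)).C else 0 := by
  have hm : (oneShotTask m).val = m'.val ∨ (oneShotTask m).val = M + m'.val ↔ m' = m := by
    simp only [oneShotTask, Fin.ext_iff]
    omega
  simp only [adSplit, if_neg (oneShotTask_ne_last m), hm]

theorem adSplit_last (m : Fin M) :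
    adSplit M τ (Fin.last (2 * M)) m = (τ (Fin.last (2 * M))).C / M := by
  simp [adSplit]

variable {τ}

theorem adSplit_nonneg (hC : ∀ i, 0 ≤ (τ i).C) (i : Fin (2 * M + 1)) (m : Fin M) :
    0 ≤ adSplit M τ i m := by
  cases i using taskCases with
  | periodic m' => rw [adSplit_periodicTask]; split_ifs <;> simp [hC]
  | oneShot m' => rw [adSplit_oneShotTask]; split_ifs <;> simp [hC]
  | last => rw [adSplit_last]; exact div_nonneg (hC _) M.cast_nonneg

theorem sum_adSplit (hM : M ≠ 0) (i : Fin (2 * M + 1)) : ∑ m, adSplit M τ i m = (τ i).C := by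
  cases i using taskCases with
  | periodic m => simp [adSplit_periodicTask]
  | oneShot m => simp [adSplit_oneShotTask]
  | last => simp [adSplit_last, mul_div_cancel₀, hM]

end Tasks

/-- An assignment of the tasks of `adTasks` to processors: processor `m` executes job `j` of its
periodic task during `periodic m j`, the first job of its one-shot task during `oneShot m`, and the
first job of the last task during `split m`. -/
structure Assignment (M : ℕ) where
  periodic : Fin M → ℕ → Set ℝ
  oneShot : Fin M → Set ℝ
  split : Fin M → Set ℝ
  measurableSet_periodic : ∀ m j, MeasurableSet (periodic m j)
  measurableSet_oneShot : ∀ m, MeasurableSet (oneShot m)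
  measurableSet_split : ∀ m, MeasurableSet (split m)
  pairwise_disjoint_periodic : ∀ m, Pairwise (Disjoint on periodic m)
  disjoint_periodic_oneShot : ∀ m j, Disjoint (periodic m j) (oneShot m)
  disjoint_periodic_split : ∀ m j, Disjoint (periodic m j) (split m)
  disjoint_oneShot_split : ∀ m, Disjoint (oneShot m) (split m)
  pairwise_disjoint_split : Pairwise (Disjoint on split)

namespace Assignment

variable {M : ℕ} (a : Assignment M)

/-- The time during which processor `m` executes job `p.2` of task `p.1`. -/
def executes (m : Fin M) (p : Fin (2 * M + 1) × ℕ) : Set ℝ :=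
  {t | (p.1 = periodicTask m ∧ t ∈ a.periodic m p.2) ∨
    (p = (oneShotTask m, 0) ∧ t ∈ a.oneShot m) ∨ (p = (Fin.last (2 * M), 0) ∧ t ∈ a.split m)}

theorem executes_periodicTask (m m' : Fin M) (j : ℕ) :
    a.executes m (periodicTask m', j) = if m = m' then a.periodic m' j else ∅ := by
  ext t
  split_ifs with h <;> simp [executes, h, eq_comm (a := m')]

theorem executes_oneShotTask (m m' : Fin M) (j : ℕ) :
    a.executes m (oneShotTask m', j) = if m = m' ∧ j = 0 then a.oneShot m' else ∅ := by
  ext t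
  split_ifs with h
  · simp [executes, h, (periodicTask_ne_oneShotTask _ _).symm]
  · simp [executes, (periodicTask_ne_oneShotTask _ _).symm, eq_comm (a := m'), h]

theorem executes_last (m : Fin M) (j : ℕ) :
    a.executes m (Fin.last (2 * M), j) = if j = 0 then a.split m else ∅ := by
  ext t
  split_ifs with h <;>
    simp [executes, h, (periodicTask_ne_last _).symm, (oneShotTask_ne_last _).symm]

theorem measurableSet_executes (m : Fin M) (p : Fin (2 * M + 1) × ℕ) :
    MeasurableSet (a.executes m p) := by
  obtain ⟨i, j⟩ := p
  cases i using taskCases with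
  | periodic m' =>
    rw [executes_periodicTask]
    split_ifs
    exacts [a.measurableSet_periodic _ _, .empty]
  | oneShot m' =>
    rw [executes_oneShotTask]
    split_ifs
    exacts [a.measurableSet_oneShot _, .empty]
  | last =>
    rw [executes_last]
    split_ifs
    exacts [a.measurableSet_split _, .empty]

theorem pairwise_disjoint_executes (m : Fin M) : Pairwise (Disjoint on a.executes m) := by
  rintro ⟨i, j⟩ ⟨i', j'⟩ hne
  refine disjoint_left.2 ?_
  rintro t (⟨rfl, h⟩ | ⟨hp, h⟩ | ⟨hp, h⟩) (⟨rfl, h'⟩ | ⟨hp', h'⟩ | ⟨hp', h'⟩)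
  · exact (a.pairwise_disjoint_periodic m fun hj => hne (Prod.ext rfl hj)).ne_of_mem h h' rfl
  · exact (a.disjoint_periodic_oneShot m j).ne_of_mem h h' rfl
  · exact (a.disjoint_periodic_split m j).ne_of_mem h h' rfl
  · exact (a.disjoint_periodic_oneShot m j').ne_of_mem h' h rfl
  · exact hne (hp.trans hp'.symm)
  · exact (a.disjoint_oneShot_split m).ne_of_mem h h' rfl
  · exact (a.disjoint_periodic_split m j').ne_of_mem h' h rfl
  · exact (a.disjoint_oneShot_split m).ne_of_mem h' h rfl
  · exact hne (hp.trans hp'.symm)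

/-- The schedule that carries out an assignment. -/
noncomputable def schedule : Schedule M (2 * M + 1) :=
  .ofSets a.measurableSet_executes a.pairwise_disjoint_executes

theorem run_schedule {m : Fin M} {p : Fin (2 * M + 1) × ℕ} {t : ℝ} :
    a.schedule.run m t = some p ↔ t ∈ a.executes m p :=
  Schedule.run_ofSets _ _

theorem serviceOn_periodicTask (m m' : Fin M) (j : ℕ) (t : ℝ) :
    a.schedule.serviceOn m (periodicTask m') j t =
      if m = m' then volume.real (a.periodic m' j ∩ Ico 0 t) else 0 := by
  rw [schedule, Schedule.serviceOn_ofSets, executes_periodicTask]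
  split_ifs <;> simp

theorem serviceOn_oneShotTask (m m' : Fin M) (j : ℕ) (t : ℝ) :
    a.schedule.serviceOn m (oneShotTask m') j t =
      if m = m' ∧ j = 0 then volume.real (a.oneShot m' ∩ Ico 0 t) else 0 := by
  rw [schedule, Schedule.serviceOn_ofSets, executes_oneShotTask]
  split_ifs <;> simp

theorem serviceOn_last (m : Fin M) (j : ℕ) (t : ℝ) :
    a.schedule.serviceOn m (Fin.last (2 * M)) j t =
      if j = 0 then volume.real (a.split m ∩ Ico 0 t) else 0 := by
  rw [schedule, Schedule.serviceOn_ofSets, executes_last]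
  split_ifs <;> simp

theorem service_periodicTask (m : Fin M) (j : ℕ) (t : ℝ) :
    a.schedule.service (periodicTask m) j t = volume.real (a.periodic m j ∩ Ico 0 t) := by
  simp [Schedule.service, serviceOn_periodicTask]

theorem service_oneShotTask (m : Fin M) (t : ℝ) :
    a.schedule.service (oneShotTask m) 0 t = volume.real (a.oneShot m ∩ Ico 0 t) := by
  simp [Schedule.service, serviceOn_oneShotTask]

theorem service_last (t : ℝ) :
    a.schedule.service (Fin.last (2 * M)) 0 t = ∑ m, volume.real (a.split m ∩ Ico 0 t) := by
  simp [Schedule.service, serviceOn_last]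

variable {a} in
theorem eq_of_mem_executes {m m' : Fin M} {i : Fin (2 * M + 1)} {j j' : ℕ} {t : ℝ}
    (h : t ∈ a.executes m (i, j)) (h' : t ∈ a.executes m' (i, j')) : m = m' := by
  cases i using taskCases with
  | periodic m₀ =>
    rw [executes_periodicTask] at h h'
    split_ifs at h h' with hm hm'
    · exact hm.trans hm'.symm
    all_goals simp_all
  | oneShot m₀ =>
    rw [executes_oneShotTask] at h h'
    split_ifs at h h' with hm hm'
    · exact hm.1.trans hm'.1.symm
    all_goals simp_all
  | last =>
    rw [executes_last] at h h'
    split_ifs at h h'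
    · exact a.pairwise_disjoint_split.eq (not_disjoint_iff.2 ⟨t, h, h'⟩)
    all_goals simp_all

variable {a} in
theorem isScheduleOf {J : Jobs (2 * M + 1)}
    (hrun : ∀ t, 0 ≤ t → ∀ i j, (∃ m, t ∈ a.executes m (i, j)) → a.schedule.Pending J i j t) :
    a.schedule.IsScheduleOf J :=
  ⟨fun t ht m i j h => hrun t ht i j ⟨m, a.run_schedule.1 h⟩,
    fun _ _ _ _ _ _ _ h h' => eq_of_mem_executes (a.run_schedule.1 h) (a.run_schedule.1 h')⟩

theorem exists_mem_executes_periodicTask {m : Fin M} {j : ℕ} {t : ℝ} :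
    (∃ m', t ∈ a.executes m' (periodicTask m, j)) ↔ t ∈ a.periodic m j := by
  simp [executes, eq_comm (a := m)]

theorem exists_mem_executes_oneShotTask {m : Fin M} {j : ℕ} {t : ℝ} :
    (∃ m', t ∈ a.executes m' (oneShotTask m, j)) ↔ j = 0 ∧ t ∈ a.oneShot m := by
  simp [executes, (periodicTask_ne_oneShotTask _ _).symm, and_assoc]

theorem exists_mem_executes_last {j : ℕ} {t : ℝ} :
    (∃ m, t ∈ a.executes m (Fin.last (2 * M), j)) ↔ j = 0 ∧ ∃ m, t ∈ a.split m := by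
  simp [executes, (periodicTask_ne_last _).symm, (oneShotTask_ne_last _).symm]

end Assignment

namespace Jobs

section Semipartition

variable {M : ℕ} (J : Jobs (2 * M + 1)) (m : Fin M)

/-- The time that processor `m` reserves for the first job of the last task, which visits the
processors one after the other, each for an equal share of its execution time. -/
def splitTime : Set ℝ :=
  slot (J.release (Fin.last (2 * M)) 0) (J.exec (Fin.last (2 * M)) 0 / M) m

/-- The time during which processor `m` executes its one-shot task, which has priority over the
periodic task. -/
def oneShotTime : Set ℝ :=
  greedy (Ici 0 \ J.splitTime m) (J.release (oneShotTask m) 0) (J.exec (oneShotTask m) 0)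

/-- The time during which processor `m` executes job `j` of its periodic task, whose jobs are
executed in the order of their releases. -/
def periodicTime (j : ℕ) : Set ℝ :=
  greedy (freeTimes ((Ici 0 \ J.splitTime m) \ J.oneShotTime m) (J.release (periodicTask m))
    (J.exec (periodicTask m)) j) (J.release (periodicTask m) j) (J.exec (periodicTask m) j)

theorem measurableSet_splitTime : MeasurableSet (J.splitTime m) :=
  measurableSet_greedy measurableSet_Ici

theorem measurableSet_oneShotTime : MeasurableSet (J.oneShotTime m) :=
  measurableSet_greedy (measurableSet_Ici.diff (J.measurableSet_splitTime m))

theorem periodicTime_subset (j : ℕ) :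
    J.periodicTime m j ⊆ (Ici 0 \ J.splitTime m) \ J.oneShotTime m :=
  greedy_subset.trans (antitone_freeTimes j.zero_le)

/-- The semi-partitioned assignment for a job sequence: on each processor, the slot of the last
task comes first, then the one-shot task, then the periodic task. -/
def semiPartition : Assignment M where
  periodic := J.periodicTime
  oneShot := J.oneShotTime
  split := J.splitTime
  measurableSet_periodic m _ :=
    measurableSet_greedy <| measurableSet_freeTimes
      ((measurableSet_Ici.diff (J.measurableSet_splitTime m)).diff
        (J.measurableSet_oneShotTime m)) _
  measurableSet_oneShot := J.measurableSet_oneShotTime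
  measurableSet_split := J.measurableSet_splitTime
  pairwise_disjoint_periodic _ := pairwise_disjoint_greedy_freeTimes
  disjoint_periodic_oneShot m j := disjoint_sdiff_left.mono_left (J.periodicTime_subset m j)
  disjoint_periodic_split m j :=
    disjoint_sdiff_left.mono_left ((J.periodicTime_subset m j).trans sdiff_subset)
  disjoint_oneShot_split _ := disjoint_sdiff_left.mono_left greedy_subset
  pairwise_disjoint_split :=
    (pairwise_disjoint_slot _ _).comp_of_injective Fin.val_injective

variable {J}

theorem sum_splitTime_lt {m : Fin M} {t : ℝ} (ht : t ∈ J.splitTime m) :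
    ∑ m, volume.real (J.splitTime m ∩ Ico 0 t) < J.exec (Fin.last (2 * M)) 0 := by
  have hM : (M : ℝ) ≠ 0 := Nat.cast_ne_zero.2 m.pos.ne'
  calc ∑ m, volume.real (J.splitTime m ∩ Ico 0 t)
      < ∑ _m : Fin M, J.exec (Fin.last (2 * M)) 0 / M :=
        Finset.sum_lt_sum
          (fun _ _ => measureReal_greedy_inter_le
            (measureReal_nonneg.trans_lt (measureReal_greedy_inter_lt ht)).le)
          ⟨m, Finset.mem_univ m, measureReal_greedy_inter_lt ht⟩
    _ = J.exec (Fin.last (2 * M)) 0 := by simp [mul_div_cancel₀, hM]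

theorem isScheduleOf_semiPartition : J.semiPartition.schedule.IsScheduleOf J := by
  refine Assignment.isScheduleOf fun t _ i j hrun => ?_
  cases i using taskCases with
  | periodic m =>
    have ht := (Assignment.exists_mem_executes_periodicTask _).1 hrun
    exact ⟨ht.2.2.1, (Assignment.service_periodicTask ..).trans_lt (measureReal_greedy_inter_lt ht)⟩
  | oneShot m =>
    obtain ⟨rfl, ht⟩ := (Assignment.exists_mem_executes_oneShotTask _).1 hrun
    exact ⟨ht.2.2.1, (Assignment.service_oneShotTask ..).trans_lt (measureReal_greedy_inter_lt ht)⟩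
  | last =>
    obtain ⟨rfl, m, ht⟩ := (Assignment.exists_mem_executes_last _).1 hrun
    exact ⟨ht.2.2.1, (Assignment.service_last ..).trans_lt (sum_splitTime_lt ht)⟩

variable (hJ : ∀ i j, 0 ≤ J.exec i j)

include hJ

theorem hasBoundedDelay_sdiff_splitTime :
    HasBoundedDelay (Ici 0 \ J.splitTime m) (J.exec (Fin.last (2 * M)) 0 / M) := by
  have h := hasBoundedDelay_Ici.sdiff (V := J.splitTime m) fun _ =>
    measureReal_greedy_inter_le (div_nonneg (hJ _ _) M.cast_nonneg)
  rwa [zero_add] at h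

theorem hasBoundedDelay_sdiff_oneShotTime :
    HasBoundedDelay ((Ici 0 \ J.splitTime m) \ J.oneShotTime m)
      (J.exec (Fin.last (2 * M)) 0 / M + J.exec (oneShotTask m) 0) :=
  (hasBoundedDelay_sdiff_splitTime m hJ).sdiff fun _ => measureReal_greedy_inter_le (hJ _ _)

variable {m} {x : ℝ}

theorem exec_le_service_last (hr : J.release (Fin.last (2 * M)) 0 ≠ ⊤) (hM : M ≠ 0)
    (hx : (J.release (Fin.last (2 * M)) 0).toReal + J.exec (Fin.last (2 * M)) 0 ≤ x) :
    J.exec (Fin.last (2 * M)) 0 ≤ J.semiPartition.schedule.service (Fin.last (2 * M)) 0 x := by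
  have hM' : (0 : ℝ) < M := by positivity
  rw [Assignment.service_last]
  calc J.exec (Fin.last (2 * M)) 0
      = ∑ _m : Fin M, J.exec (Fin.last (2 * M)) 0 / M := by simp [mul_div_cancel₀, hM]
    _ ≤ ∑ m, volume.real (J.splitTime m ∩ Ico 0 x) := Finset.sum_le_sum fun m _ => ?_
  have hshare : 0 ≤ J.exec (Fin.last (2 * M)) 0 / M := div_nonneg (hJ _ _) hM'.le
  refine le_measureReal_slot_inter hr hshare (le_trans ?_ hx)
  gcongr
  have hm : (m : ℝ) + 1 ≤ M := by exact_mod_cast m.isLt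
  calc ((m : ℝ) + 1) * (J.exec (Fin.last (2 * M)) 0 / M)
      ≤ M * (J.exec (Fin.last (2 * M)) 0 / M) := by gcongr
    _ = J.exec (Fin.last (2 * M)) 0 := by field_simp

theorem exec_le_service_oneShotTask (hr : J.release (oneShotTask m) 0 ≠ ⊤)
    (hx : (J.release (oneShotTask m) 0).toReal + J.exec (Fin.last (2 * M)) 0 / M +
      J.exec (oneShotTask m) 0 ≤ x) :
    J.exec (oneShotTask m) 0 ≤ J.semiPartition.schedule.service (oneShotTask m) 0 x := by
  rw [Assignment.service_oneShotTask]
  have hfree := hasBoundedDelay_sdiff_splitTime m hJ (J.release (oneShotTask m) 0).toReal x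
    ENNReal.toReal_nonneg
  exact le_measureReal_greedy_inter hr (by linarith)

theorem exec_le_service_periodicTask
    (hgap : ∀ j, J.release (periodicTask m) j + ENNReal.ofReal (J.exec (periodicTask m) j) ≤
      J.release (periodicTask m) (j + 1))
    {j : ℕ} (hr : J.release (periodicTask m) j ≠ ⊤)
    (hx : (J.release (periodicTask m) j).toReal + J.exec (Fin.last (2 * M)) 0 / M +
      J.exec (oneShotTask m) 0 + J.exec (periodicTask m) j ≤ x) :
    J.exec (periodicTask m) j ≤ J.semiPartition.schedule.service (periodicTask m) j x := by
  rw [Assignment.service_periodicTask]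
  have hfree := (hasBoundedDelay_sdiff_oneShotTime m hJ).le_measureReal_freeTimes hgap
    (hJ (periodicTask m)) j hr x
  exact le_measureReal_greedy_inter hr (by linarith)

end Semipartition

theorem Legal.release_succ_eq_top {N : ℕ} {τ : Fin N → Task} {J : Jobs N} (hJ : J.Legal τ)
    {i : Fin N} (hi : (τ i).T = ⊤) (j : ℕ) : J.release i (j + 1) = ⊤ := by
  simpa [hi] using hJ.1 i j

end Jobs

section Feasibility

variable {M : ℕ} {τ : Fin (2 * M + 1) → Task} {J : Jobs (2 * M + 1)}

theorem serviceOn_semiPartition_le (hJ : J.Legal τ) (hC : ∀ i, 0 ≤ (τ i).C) (i : Fin (2 * M + 1))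
    (j : ℕ) (m : Fin M) (t : ℝ) :
    J.semiPartition.schedule.serviceOn m i j t ≤ adSplit M τ i m := by
  have hexec : ∀ i j, 0 ≤ J.exec i j := fun i j => (hJ.2 i j).1.le
  cases i using taskCases with
  | periodic m' =>
    rw [Assignment.serviceOn_periodicTask, adSplit_periodicTask]
    split_ifs
    · exact (measureReal_greedy_inter_le (hexec _ _)).trans (hJ.2 _ _).2
    · exact le_rfl
  | oneShot m' =>
    rw [Assignment.serviceOn_oneShotTask]
    split_ifs with h
    · rw [adSplit_oneShotTask, if_pos h.1]
      exact (measureReal_greedy_inter_le (hexec _ _)).trans (hJ.2 _ _).2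
    · exact adSplit_nonneg hC _ _
  | last =>
    rw [Assignment.serviceOn_last]
    split_ifs
    · rw [adSplit_last]
      exact (measureReal_greedy_inter_le (div_nonneg (hexec _ _) M.cast_nonneg)).trans
        (by gcongr; exact (hJ.2 _ _).2)
    · exact adSplit_nonneg hC _ _

/-- The load conditions under which `Jobs.semiPartition` meets all deadlines: on each processor the
share of the last task together with the one-shot task, and with one job of the periodic task, fits
into the respective deadline. -/
structure FitsSemiPartition (τ : Fin (2 * M + 1) → Task) : Prop where
  C_nonneg : ∀ i, 0 ≤ (τ i).C
  C_le_T : ∀ m, ENNReal.ofReal (τ (periodicTask m)).C ≤ (τ (periodicTask m)).T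
  T_oneShotTask : ∀ m, (τ (oneShotTask m)).T = ⊤
  T_last : (τ (Fin.last (2 * M))).T = ⊤
  periodicTask_le : ∀ m, (τ (Fin.last (2 * M))).C / M + (τ (oneShotTask m)).C +
    (τ (periodicTask m)).C ≤ (τ (periodicTask m)).D
  oneShotTask_le : ∀ m, (τ (Fin.last (2 * M))).C / M + (τ (oneShotTask m)).C ≤
    (τ (oneShotTask m)).D
  last_le : (τ (Fin.last (2 * M))).C ≤ (τ (Fin.last (2 * M))).D

theorem FitsSemiPartition.meetsDeadline (hτ : FitsSemiPartition τ) (hM : M ≠ 0) (hJ : J.Legal τ)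
    (i : Fin (2 * M + 1)) (j : ℕ) : J.semiPartition.schedule.MeetsDeadline τ J i j := by
  intro hr
  have hexec : ∀ i j, 0 ≤ J.exec i j := fun i j => (hJ.2 i j).1.le
  have hC : ∀ i j, J.exec i j ≤ (τ i).C := fun i j => (hJ.2 i j).2
  have hshare : J.exec (Fin.last (2 * M)) 0 / M ≤ (τ (Fin.last (2 * M))).C / M := by
    gcongr
    exact hC _ _
  cases i using taskCases with
  | periodic m =>
    have hgap : ∀ j, J.release (periodicTask m) j + ENNReal.ofReal (J.exec (periodicTask m) j) ≤
        J.release (periodicTask m) (j + 1) := fun j =>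
      le_trans (by grw [hC _ j, hτ.C_le_T m]) (hJ.1 (periodicTask m) j)
    exact Jobs.exec_le_service_periodicTask hexec hgap hr
      (by linarith [hτ.periodicTask_le m, hC (oneShotTask m) 0, hC (periodicTask m) j])
  | oneShot m =>
    cases j with
    | zero =>
      exact Jobs.exec_le_service_oneShotTask hexec hr
        (by linarith [hτ.oneShotTask_le m, hC (oneShotTask m) 0])
    | succ j => exact absurd (hJ.release_succ_eq_top (hτ.T_oneShotTask m) j) hr
  | last =>
    cases j with
    | zero =>
      exact Jobs.exec_le_service_last hexec hr hM
        (by linarith [hτ.last_le, hC (Fin.last (2 * M)) 0])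
    | succ j => exact absurd (hJ.release_succ_eq_top hτ.T_last j) hr

theorem FitsSemiPartition.semiPartitionedFeasible (hτ : FitsSemiPartition τ) (hM : M ≠ 0) :
    SemiPartitionedFeasible M τ (adSplit M τ) :=
  ⟨adSplit_nonneg hτ.C_nonneg, sum_adSplit hM, fun J hJ =>
    ⟨J.semiPartition.schedule, Jobs.isScheduleOf_semiPartition, hτ.meetsDeadline hM hJ,
      serviceOn_semiPartition_le hJ hτ.C_nonneg⟩⟩

variable {ε η v : ℝ}

theorem adTasks_C_pos (hε : 0 < ε) (i : Fin (2 * M + 1)) : 0 < (adTasks M ε η i).C := by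
  cases i using taskCases with
  | periodic m => rw [adTasks_periodicTask]; positivity
  | oneShot m => rw [adTasks_oneShotTask]; positivity
  | last => rw [adTasks_last]; positivity

theorem valid_atSpeed_adTasks (hε : 0 < ε) (hη : 0 < η) (hv : (1 + ε) / 3 ≤ v)
    (i : Fin (2 * M + 1)) : (atSpeed v (adTasks M ε η) i).Valid := by
  have hv0 : 0 < v := by linarith
  refine ⟨div_pos (adTasks_C_pos hε i) hv0, ?_⟩
  cases i using taskCases with
  | periodic m =>
    simp only [atSpeed, adTasks_periodicTask]
    exact ⟨one_pos, by simpa using hε, by rw [div_le_one hv0]; linarith,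
      ENNReal.ofReal_le_ofReal (by rw [div_le_iff₀ hv0]; nlinarith)⟩
  | oneShot m =>
    simp only [atSpeed, adTasks_oneShotTask]
    have hC : 1 / 3 / v ≤ 1 := by rw [div_le_one hv0]; linarith
    exact ⟨by positivity, by simp, by linarith, le_top⟩
  | last =>
    simp only [atSpeed, adTasks_last]
    have hC : (1 + ε) / 3 / v ≤ 1 := by rwa [div_le_one hv0]
    exact ⟨by positivity, by simp, by linarith, le_top⟩

theorem div_three_le_of_load_le (hε : 0 < ε)
    (hv : (1 + ε) / 3 + (1 + ε) / (3 * (M : ℝ)) ≤ v) : (1 + ε) / 3 ≤ v := by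
  have : 0 ≤ (1 + ε) / (3 * (M : ℝ)) := by positivity
  linarith

theorem fitsSemiPartition_atSpeed_adTasks (hε : 0 < ε) (hη : 0 < η)
    (hv : (1 + ε) / 3 + (1 + ε) / (3 * (M : ℝ)) ≤ v) :
    FitsSemiPartition (atSpeed v (adTasks M ε η)) := by
  have hv3 := div_three_le_of_load_le hε hv
  have hv0 : 0 < v := by linarith
  have hvalid := valid_atSpeed_adTasks (M := M) hε hη hv3
  have hload : (1 + ε) / 3 / v / M + 1 / 3 / v + ε / 3 / v ≤ 1 := by
    rw [← div_le_one hv0] at hv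
    exact hv.trans' (le_of_eq (by ring))
  have hε' : 0 < ε / 3 / v := by positivity
  exact
    { C_nonneg := fun i => (hvalid i).1.le
      C_le_T := fun m => (hvalid _).2.2.2.2
      T_oneShotTask := fun m => by simp [atSpeed]
      T_last := by simp [atSpeed]
      periodicTask_le := fun m => by simpa only [atSpeed, adTasks_last, adTasks_oneShotTask,
        adTasks_periodicTask] using hload
      oneShotTask_le := fun m => by
        simp only [atSpeed, adTasks_last, adTasks_oneShotTask]
        linarith
      last_le := (hvalid _).2.2.2.1 }

end Feasibility

section PriorityOrder

variable {M : ℕ} {ε η : ℝ} {prio : Equiv.Perm (Fin (2 * M + 1))}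

theorem IsDM.periodicTask_lt_oneShotTask (h : IsDM (adTasks M ε η) prio) (hη : 0 < η)
    (m m' : Fin M) : prio (periodicTask m) < prio (oneShotTask m') :=
  h _ _ (by simpa using hη)

theorem IsDM.oneShotTask_lt_last (h : IsDM (adTasks M ε η) prio) (hη : 0 < η) (m : Fin M) :
    prio (oneShotTask m) < prio (Fin.last (2 * M)) :=
  h _ _ (by simpa only [adTasks_oneShotTask, adTasks_last] using by linarith)

theorem IsDM.periodicTask_lt_last (h : IsDM (adTasks M ε η) prio) (hη : 0 < η) (m : Fin M) :
    prio (periodicTask m) < prio (Fin.last (2 * M)) :=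
  (h.periodicTask_lt_oneShotTask hη m m).trans (h.oneShotTask_lt_last hη m)

theorem ncard_lt_of_subset_range {α : Type*} {f : Fin M → α} {s : Set α} {m : Fin M}
    (hs : s ⊆ range f) (hm : f m ∉ s) : s.ncard < M := by
  have hssub : s ⊂ range f := ⟨hs, fun h => hm (h ⟨m, rfl⟩)⟩
  refine (ncard_lt_ncard hssub (finite_range f)).trans_le ?_
  rw [← image_univ]
  exact (ncard_image_le finite_univ).trans (by simp)

theorem le_ncard_of_range_subset {α : Type*} [Finite α] {f : Fin M → α} (hf : Injective f)
    {s : Set α} (hs : range f ⊆ s) : M ≤ s.ncard := by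
  refine le_trans ?_ (ncard_le_ncard hs (toFinite s))
  rw [← image_univ, ncard_image_of_injective _ hf]
  simp

variable {active : Fin (2 * M + 1) → Prop} {P Q : Prop}

theorem IsDM.ncard_above_periodicTask_lt (h : IsDM (adTasks M ε η) prio) (hη : 0 < η)
    (m : Fin M) : {k | active k ∧ prio k < prio (periodicTask m)}.ncard < M := by
  refine ncard_lt_of_subset_range (f := periodicTask) (m := m) ?_ fun hm => lt_irrefl _ hm.2
  rintro k ⟨-, hk⟩
  cases k using taskCases with
  | periodic m' => exact ⟨m', rfl⟩
  | oneShot m' => exact absurd hk (h.periodicTask_lt_oneShotTask hη m m').not_gt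
  | last => exact absurd hk (h.periodicTask_lt_last hη m).not_gt

theorem IsDM.ncard_above_oneShotTask_lt_iff (h : IsDM (adTasks M ε η) prio) (hη : 0 < η)
    (hper : ∀ m, active (periodicTask m) ↔ P) (m : Fin M) :
    {k | active k ∧ prio k < prio (oneShotTask m)}.ncard < M ↔ ¬ P := by
  refine ⟨fun hlt hP => hlt.not_ge (le_ncard_of_range_subset (f := periodicTask)
    (fun _ _ => periodicTask_inj.1) ?_), fun hP => ?_⟩
  · rintro _ ⟨m', rfl⟩
    exact ⟨(hper m').2 hP, h.periodicTask_lt_oneShotTask hη m' m⟩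
  · refine ncard_lt_of_subset_range (f := oneShotTask) (m := m) ?_ fun hm => lt_irrefl _ hm.2
    rintro k ⟨hact, hk⟩
    cases k using taskCases with
    | periodic m' => exact absurd ((hper m').1 hact) hP
    | oneShot m' => exact ⟨m', rfl⟩
    | last => exact absurd hk (h.oneShotTask_lt_last hη m).not_gt

theorem IsDM.ncard_above_last_lt_iff (h : IsDM (adTasks M ε η) prio) (hη : 0 < η) (hM : 0 < M)
    (hper : ∀ m, active (periodicTask m) ↔ P) (hone : ∀ m, active (oneShotTask m) ↔ Q) :
    {k | active k ∧ prio k < prio (Fin.last (2 * M))}.ncard < M ↔ ¬ P ∧ ¬ Q := by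
  refine ⟨fun hlt => ⟨fun hP => hlt.not_ge ?_, fun hQ => hlt.not_ge ?_⟩, fun ⟨hP, hQ⟩ => ?_⟩
  · refine le_ncard_of_range_subset (f := periodicTask) (fun _ _ => periodicTask_inj.1) ?_
    rintro _ ⟨m, rfl⟩
    exact ⟨(hper m).2 hP, h.periodicTask_lt_last hη m⟩
  · refine le_ncard_of_range_subset (f := oneShotTask) (fun _ _ => oneShotTask_inj.1) ?_
    rintro _ ⟨m, rfl⟩
    exact ⟨(hone m).2 hQ, h.oneShotTask_lt_last hη m⟩
  · suffices {k | active k ∧ prio k < prio (Fin.last (2 * M))} = ∅ by simpa [this] using hM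
    refine eq_empty_of_forall_notMem ?_
    rintro k ⟨hact, hk⟩
    cases k using taskCases with
    | periodic m => exact hP ((hper m).1 hact)
    | oneShot m => exact hQ ((hone m).1 hact)
    | last => exact lt_irrefl _ hk

end PriorityOrder

section SynchronousDM

/-- The time during which the `j`-th jobs of all periodic tasks are executed by global DM. -/
def periodicSlot (ε : ℝ) (j : ℕ) : Set ℝ :=
  Ico (j * ε) (j * ε + ε / 3)

/-- The time that the periodic tasks leave to the other tasks under global DM. -/
def gapTime (ε : ℝ) : Set ℝ :=
  Ici 0 \ ⋃ j, periodicSlot ε j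

/-- The time during which all one-shot tasks are executed by global DM. -/
def dmOneShotTime (ε : ℝ) : Set ℝ :=
  greedy (gapTime ε) 0 (1 / 3)

/-- The time during which the last task is executed by global DM. -/
def dmLastTime (ε : ℝ) : Set ℝ :=
  greedy (gapTime ε \ dmOneShotTime ε) 0 ((1 + ε) / 3)

variable {M : ℕ} {m₀ : Fin M} {ε η t x : ℝ}

theorem pairwise_disjoint_periodicSlot : Pairwise (Disjoint on periodicSlot ε) := by
  have hsub : ∀ j : ℕ, periodicSlot ε j ⊆ Ico (0 + j * ε) (0 + (j + 1) * ε) :=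
    fun j t ⟨hjt, htj⟩ => ⟨by linarith, by linarith⟩
  exact (pairwise_disjoint_Ico_add_mul 0 ε).mono fun i j h => h.mono (hsub i) (hsub j)

theorem notMem_gapTime_iff (ht : 0 ≤ t) : t ∉ gapTime ε ↔ ∃ j, t ∈ periodicSlot ε j := by
  simp [gapTime, ht]

theorem measurableSet_gapTime : MeasurableSet (gapTime ε) :=
  measurableSet_Ici.diff (.iUnion fun _ => measurableSet_Ico)

theorem measurableSet_dmOneShotTime : MeasurableSet (dmOneShotTime ε) :=
  measurableSet_greedy measurableSet_gapTime

theorem measurableSet_dmLastTime : MeasurableSet (dmLastTime ε) :=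
  measurableSet_greedy (measurableSet_gapTime.diff measurableSet_dmOneShotTime)

theorem disjoint_periodicSlot_gapTime (j : ℕ) : Disjoint (periodicSlot ε j) (gapTime ε) :=
  disjoint_sdiff_right.mono_left (subset_iUnion _ j)

/-- The assignment produced by global DM, under any tie-breaking, on the synchronous job sequence of
`adTasks`. The last task runs only while all other tasks are idle, and is put on processor `m₀`. -/
noncomputable def dmAssignment (m₀ : Fin M) (ε : ℝ) : Assignment M where
  periodic _ := periodicSlot ε
  oneShot _ := dmOneShotTime ε
  split m := {t | m = m₀ ∧ t ∈ dmLastTime ε}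
  measurableSet_periodic _ _ := measurableSet_Ico
  measurableSet_oneShot _ := measurableSet_dmOneShotTime
  measurableSet_split _ := (MeasurableSet.const _).inter measurableSet_dmLastTime
  pairwise_disjoint_periodic _ := pairwise_disjoint_periodicSlot
  disjoint_periodic_oneShot _ j := (disjoint_periodicSlot_gapTime j).mono_right greedy_subset
  disjoint_periodic_split _ j := (disjoint_periodicSlot_gapTime j).mono_right
    fun _ ht => (greedy_subset ht.2).1
  disjoint_oneShot_split _ := disjoint_sdiff_right.mono_right fun _ ht => greedy_subset ht.2
  pairwise_disjoint_split _ _ hne :=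
    disjoint_left.2 fun _ h h' => hne (h.1.trans h'.1.symm)

theorem service_dmAssignment_last (t : ℝ) :
    (dmAssignment m₀ ε).schedule.service (Fin.last (2 * M)) 0 t =
      volume.real (dmLastTime ε ∩ Ico 0 t) := by
  rw [Assignment.service_last, Finset.sum_eq_single m₀] <;> simp +contextual [dmAssignment]

theorem pending_periodicTask_iff (hε : 0 < ε) (ht : 0 ≤ t) (m : Fin M) (j : ℕ) :
    (dmAssignment m₀ ε).schedule.Pending (synchronous (adTasks M ε η)) (periodicTask m) j t ↔
      t ∈ periodicSlot ε j := by
  have hj : 0 ≤ j * ε := by positivity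
  have hrelease : (j : ℝ≥0∞) * ENNReal.ofReal ε ≤ ENNReal.ofReal t ↔ j * ε ≤ t := by
    rw [← ENNReal.ofReal_natCast, ← ENNReal.ofReal_mul j.cast_nonneg,
      ENNReal.ofReal_le_ofReal_iff ht]
  have hunfinished : volume.real (periodicSlot ε j ∩ Ico 0 t) < ε / 3 ↔ t < j * ε + ε / 3 := by
    rw [periodicSlot, Ico_inter_Ico, Real.volume_real_Ico, max_eq_left hj, max_lt_iff,
      sub_lt_iff_lt_add', min_lt_iff]
    simp [hε]
  rw [Schedule.Pending, Assignment.service_periodicTask]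
  simp only [synchronous, adTasks_periodicTask, dmAssignment, hrelease, hunfinished]
  rfl

theorem pending_oneShotTask_iff (m : Fin M) (j : ℕ) :
    (dmAssignment m₀ ε).schedule.Pending (synchronous (adTasks M ε η)) (oneShotTask m) j t ↔
      j = 0 ∧ volume.real (gapTime ε ∩ Ico 0 t) < 1 / 3 := by
  cases j with
  | succ j => simp [Schedule.Pending, synchronous, ENNReal.mul_top]
  | zero =>
    have hservice : volume.real (dmOneShotTime ε ∩ Ico 0 t) =
        min (volume.real (gapTime ε ∩ Ico 0 t)) (1 / 3) :=
      measureReal_greedy_inter ENNReal.zero_ne_top (by norm_num)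
    rw [Schedule.Pending, Assignment.service_oneShotTask]
    simp [synchronous, dmAssignment, hservice]

theorem pending_last_iff (hε : 0 < ε) (j : ℕ) :
    (dmAssignment m₀ ε).schedule.Pending (synchronous (adTasks M ε η)) (Fin.last (2 * M)) j t ↔
      j = 0 ∧ volume.real ((gapTime ε \ dmOneShotTime ε) ∩ Ico 0 t) < (1 + ε) / 3 := by
  cases j with
  | succ j => simp [Schedule.Pending, synchronous, ENNReal.mul_top]
  | zero =>
    have hservice : volume.real (dmLastTime ε ∩ Ico 0 t) =
        min (volume.real ((gapTime ε \ dmOneShotTime ε) ∩ Ico 0 t)) ((1 + ε) / 3) :=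
      measureReal_greedy_inter ENNReal.zero_ne_top (by positivity)
    rw [Schedule.Pending, service_dmAssignment_last]
    simp [synchronous, hservice]

theorem mem_dmOneShotTime_iff (ht : 0 ≤ t) :
    t ∈ dmOneShotTime ε ↔ t ∈ gapTime ε ∧ volume.real (gapTime ε ∩ Ico 0 t) < 1 / 3 := by
  simp [dmOneShotTime, greedy, ht]

theorem mem_dmLastTime_iff (ht : 0 ≤ t) :
    t ∈ dmLastTime ε ↔ t ∈ gapTime ε \ dmOneShotTime ε ∧
      volume.real ((gapTime ε \ dmOneShotTime ε) ∩ Ico 0 t) < (1 + ε) / 3 := by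
  simp [dmLastTime, greedy, ht]

theorem exists_mem_executes_dmAssignment_iff {prio : Equiv.Perm (Fin (2 * M + 1))}
    (hprio : IsDM (adTasks M ε η) prio) (hε : 0 < ε) (hη : 0 < η) (ht : 0 ≤ t)
    (i : Fin (2 * M + 1)) (j : ℕ) :
    (∃ m, t ∈ (dmAssignment m₀ ε).executes m (i, j)) ↔
      (dmAssignment m₀ ε).schedule.Pending (synchronous (adTasks M ε η)) i j t ∧
      (∀ j' < j,
        ¬ (dmAssignment m₀ ε).schedule.Pending (synchronous (adTasks M ε η)) i j' t) ∧
      {k | (dmAssignment m₀ ε).schedule.Active (synchronous (adTasks M ε η)) k t ∧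
        prio k < prio i}.ncard < M := by
  have hper (m) : (dmAssignment m₀ ε).schedule.Active (synchronous (adTasks M ε η))
      (periodicTask m) t ↔ t ∉ gapTime ε := by
    simp only [Schedule.Active, pending_periodicTask_iff hε ht, notMem_gapTime_iff ht]
  have hone (m) : (dmAssignment m₀ ε).schedule.Active (synchronous (adTasks M ε η))
      (oneShotTask m) t ↔ volume.real (gapTime ε ∩ Ico 0 t) < 1 / 3 := by
    simp only [Schedule.Active, pending_oneShotTask_iff, exists_eq_left]
  cases i using taskCases with
  | periodic m =>
    have hdisj : t ∈ periodicSlot ε j → ∀ j' < j, t ∉ periodicSlot ε j' := fun h j' hj' h' =>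
      (pairwise_disjoint_periodicSlot hj'.ne).ne_of_mem h' h rfl
    rw [Assignment.exists_mem_executes_periodicTask]
    simp only [pending_periodicTask_iff hε ht, hprio.ncard_above_periodicTask_lt hη, and_true]
    exact (and_iff_left_of_imp hdisj).symm
  | oneShot m =>
    rw [Assignment.exists_mem_executes_oneShotTask, hprio.ncard_above_oneShotTask_lt_iff hη hper,
      not_not]
    simp only [pending_oneShotTask_iff]
    change j = 0 ∧ t ∈ dmOneShotTime ε ↔ _
    have hmem := mem_dmOneShotTime_iff (ε := ε) ht
    grind
  | last =>
    rw [Assignment.exists_mem_executes_last, hprio.ncard_above_last_lt_iff hη m₀.pos hper hone,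
      not_not]
    simp only [pending_last_iff hε]
    change j = 0 ∧ (∃ m, m = m₀ ∧ t ∈ dmLastTime ε) ↔ _
    have hmem := mem_dmLastTime_iff (ε := ε) ht
    have hone_mem := mem_dmOneShotTime_iff (ε := ε) ht
    grind

theorem isGlobalFP_dmAssignment {prio : Equiv.Perm (Fin (2 * M + 1))}
    (hprio : IsDM (adTasks M ε η) prio) (hε : 0 < ε) (hη : 0 < η) :
    (dmAssignment m₀ ε).schedule.IsGlobalFP (synchronous (adTasks M ε η)) prio := by
  refine ⟨Assignment.isScheduleOf fun t ht i j h =>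
    ((exists_mem_executes_dmAssignment_iff hprio hε hη ht i j).1 h).1, fun t ht i j => ?_⟩
  simp only [Assignment.run_schedule]
  exact exists_mem_executes_dmAssignment_iff hprio hε hη ht i j

theorem measureReal_gapTime_inter_le_of_le_mul (hε : 0 < ε) (k : ℕ) (hx : 0 ≤ x)
    (hk : x ≤ k * ε) : volume.real (gapTime ε ∩ Ico 0 x) ≤ 2 / 3 * x := by
  induction k generalizing x with
  | zero => simp [Ico_eq_empty_of_le (show x ≤ 0 by simpa using hk), hx]
  | succ k ih =>
    push_cast at hk
    obtain hxk | hkx := le_total x (k * ε)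
    · exact ih hx hxk
    have hsub : gapTime ε ∩ Ico 0 x ⊆
        gapTime ε ∩ Ico 0 (k * ε) ∪ Ico (k * ε + ε / 3) x := by
      rintro t ⟨hgap, ht0, htx⟩
      obtain htk | hkt := lt_or_ge t (k * ε)
      · exact .inl ⟨hgap, ht0, htk⟩
      · refine .inr ⟨not_lt.1 fun hlt => ?_, htx⟩
        exact (disjoint_periodicSlot_gapTime k).ne_of_mem ⟨hkt, hlt⟩ hgap rfl
    have hlast : volume.real (Ico (k * ε + ε / 3) x) ≤ 2 / 3 * (x - k * ε) := by
      rw [Real.volume_real_Ico, max_le_iff]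
      constructor <;> linarith
    linarith [ih (x := k * ε) (by positivity) le_rfl,
      measureReal_le_add_of_subset_union hsub (volume_inter_Ico_ne_top _ _ _) (by simp)]

theorem measureReal_gapTime_inter_le (hε : 0 < ε) (hx : 0 ≤ x) :
    volume.real (gapTime ε ∩ Ico 0 x) ≤ 2 / 3 * x :=
  measureReal_gapTime_inter_le_of_le_mul hε ⌈x / ε⌉₊ hx ((div_le_iff₀ hε).1 (Nat.le_ceil _))

theorem not_meetsDeadline_dmAssignment (hη : 0 < η) (hηε : η < ε / 4) :
    ¬ (dmAssignment m₀ ε).schedule.MeetsDeadline (adTasks M ε η) (synchronous (adTasks M ε η))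
      (Fin.last (2 * M)) 0 := by
  intro hmeets
  have hservice : (1 + ε) / 3 ≤ volume.real (dmLastTime ε ∩ Ico 0 (1 + 2 * η)) := by
    have h := hmeets (by simp [synchronous])
    rw [service_dmAssignment_last] at h
    simpa [synchronous] using h
  have hleft : volume.real (dmLastTime ε ∩ Ico 0 (1 + 2 * η)) ≤
      max (volume.real (gapTime ε ∩ Ico 0 (1 + 2 * η)) - 1 / 3) 0 :=
    measureReal_greedy_inter_le_left.trans
      (measureReal_sdiff_greedy_inter measurableSet_gapTime (by norm_num)).le
  have hgap := measureReal_gapTime_inter_le (ε := ε) (x := 1 + 2 * η) (by linarith) (by linarith)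
  rcases le_max_iff.1 (hservice.trans hleft) with h | h <;> linarith

end SynchronousDM

theorem legal_synchronous {N : ℕ} {τ : Fin N → Task} (hτ : ∀ i, 0 < (τ i).C) :
    (synchronous τ).Legal τ :=
  ⟨fun i j => by simp [synchronous, add_mul], fun i _ => ⟨hτ i, le_rfl⟩⟩

theorem SemiPartitionedFeasible.feasible {M N : ℕ} {τ : Fin N → Task} {b : Fin N → Fin M → ℝ}
    (h : SemiPartitionedFeasible M τ b) : Feasible M τ := fun J hJ =>
  let ⟨S, hS, hmeets, _⟩ := h.2.2 J hJ
  ⟨S, hS, hmeets⟩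

theorem atSpeed_atSpeed_one_div {N : ℕ} {s : ℝ} (hs : s ≠ 0) (τ : Fin N → Task) :
    atSpeed s (atSpeed (1 / s) τ) = τ := by
  funext i
  simp [atSpeed, hs]

section Speedup

variable {M : ℕ} {ε η s v : ℝ} {rule : DMRule}

theorem exists_isGlobalFP_not_meetsDeadline (hM : 0 < M) (hη : 0 < η) (hηε : η < ε / 4)
    {prio : Equiv.Perm (Fin (2 * M + 1))} (hprio : IsDM (adTasks M ε η) prio) :
    ∃ S : Schedule M (2 * M + 1), S.IsGlobalFP (synchronous (adTasks M ε η)) prio ∧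
      ¬ S.MeetsDeadline (adTasks M ε η) (synchronous (adTasks M ε η)) (Fin.last (2 * M)) 0 :=
  ⟨(dmAssignment ⟨0, hM⟩ ε).schedule, isGlobalFP_dmAssignment hprio (by linarith) hη,
    not_meetsDeadline_dmAssignment hη hηε⟩

theorem not_hasSpeedupBound (hM : 0 < M) (hε : 0 < ε)
    (hs : (1 + ε) / 3 + (1 + ε) / (3 * (M : ℝ)) ≤ 1 / s) : ¬ HasSpeedupBound M rule s := by
  rintro ⟨hs0, hbound⟩
  have hη : 0 < ε / 8 := by positivity
  have hsched := hbound _ (atSpeed (1 / s) (adTasks M ε (ε / 8)))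
    (valid_atSpeed_adTasks hε hη (div_three_le_of_load_le hε hs))
    ((fitsSemiPartition_atSpeed_adTasks hε hη hs).semiPartitionedFeasible hM.ne').feasible
  rw [atSpeed_atSpeed_one_div hs0.ne'] at hsched
  obtain ⟨S, hS, hmiss⟩ := exists_isGlobalFP_not_meetsDeadline hM hη (by linarith)
    (rule.isDM _ (adTasks M ε (ε / 8)))
  exact hmiss (hsched _ (legal_synchronous (adTasks_C_pos hε)) S hS _ _)

theorem HasSpeedupBound.le (hM : 0 < M) (h : HasSpeedupBound M rule s) :
    3 - 3 / ((M : ℝ) + 1) ≤ s := by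
  by_contra! hlt
  have hs := h.1
  have : (0 : ℝ) < M := by exact_mod_cast hM
  -- The value of `ε` at which the semi-partitioned schedule needs exactly the speed `1 / s`.
  have hε : 0 < 3 * M / ((M + 1) * s) - 1 := by
    have hlt' : s < 3 * M / (M + 1) := hlt.trans_eq (by field_simp; ring)
    rw [lt_div_iff₀ (by positivity)] at hlt'
    rw [sub_pos, one_lt_div (by positivity)]
    linarith
  refine not_hasSpeedupBound hM hε (le_of_eq ?_) h
  field_simp
  ring

end Speedup

end GlobalDM

theorem theorem5p4_general (M : ℕ) (hM : 0 < M) :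
    (∀ (rule : GlobalDM.DMRule) (s : ℝ),
      GlobalDM.HasSpeedupBound M rule s → 3 - 3 / ((M : ℝ) + 1) ≤ s) ∧
    (∀ ε η : ℝ, 0 < η → η < ε / 4 →
      (∀ prio : Equiv.Perm (Fin (2 * M + 1)), GlobalDM.IsDM (GlobalDM.adTasks M ε η) prio →
        ∃ S : GlobalDM.Schedule M (2 * M + 1),
          S.IsGlobalFP (GlobalDM.synchronous (GlobalDM.adTasks M ε η)) prio ∧
          ¬ S.MeetsDeadline (GlobalDM.adTasks M ε η)
              (GlobalDM.synchronous (GlobalDM.adTasks M ε η)) (Fin.last (2 * M)) 0) ∧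
      (∀ v : ℝ, (1 + ε) / 3 + (1 + ε) / (3 * (M : ℝ)) ≤ v →
        GlobalDM.SemiPartitionedFeasible M
          (GlobalDM.atSpeed v (GlobalDM.adTasks M ε η))
          (GlobalDM.adSplit M (GlobalDM.atSpeed v (GlobalDM.adTasks M ε η))))) := by
  refine ⟨fun _ _ h => h.le hM, fun ε η hη hηε => ⟨fun _ hprio =>
    GlobalDM.exists_isGlobalFP_not_meetsDeadline hM hη hηε hprio, fun v hv => ?_⟩⟩
  exact (GlobalDM.fitsSemiPartition_atSpeed_adTasks (by linarith) hη hv).semiPartitionedFeasible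
    hM.ne'

theorem theorem5p4 (M : ℕ) (hM : 2 ≤ M) :
    (∀ (rule : GlobalDM.DMRule) (s : ℝ),
      GlobalDM.HasSpeedupBound M rule s → 3 - 3 / ((M : ℝ) + 1) ≤ s) ∧
    (∀ (n : ℕ) (ε : ℝ), 0 < n → ε = 1 / (n : ℝ) →
      ∃ η₀ : ℝ, 0 < η₀ ∧ ∀ η : ℝ, 0 < η → η < η₀ →
        (∀ prio : Equiv.Perm (Fin (2 * M + 1)), GlobalDM.IsDM (GlobalDM.adTasks M ε η) prio →
          ∃ S : GlobalDM.Schedule M (2 * M + 1),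
            S.IsGlobalFP (GlobalDM.synchronous (GlobalDM.adTasks M ε η)) prio ∧
            ¬ S.MeetsDeadline (GlobalDM.adTasks M ε η)
                (GlobalDM.synchronous (GlobalDM.adTasks M ε η)) (Fin.last (2 * M)) 0) ∧
        (∀ v : ℝ, (1 + ε) / 3 + (1 + ε) / (3 * (M : ℝ)) ≤ v →
          GlobalDM.SemiPartitionedFeasible M
            (GlobalDM.atSpeed v (GlobalDM.adTasks M ε η))
            (GlobalDM.adSplit M (GlobalDM.atSpeed v (GlobalDM.adTasks M ε η))))) := by
  obtain ⟨hbound, htasks⟩ := theorem5p4_general M (by omega)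
  exact ⟨hbound, fun n ε hn hε => ⟨ε / 4, by rw [hε]; positivity, htasks ε⟩⟩
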